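/- Let $\mathcal M$ be a von Neumann algebra with predual $\mathcal M_*$, and let $\mathfrak X$ be a Hilbert C*-module over $\mathcal M$, i.e. a right $\mathcal M$-module and complex vector space with an $\mathcal M$-valued inner product $\langle\cdot,\cdot\rangle$ (conjugate linear in the first variable, linear in the second, with $\langle\xi,\eta x\rangle=\langle\xi,\eta\rangle x$ for $x\in\mathcal M$, $\langle\xi,\eta\rangle=\langle\eta,\xi\rangle^*$, $\langle\xi,\xi\rangle\ge 0$, and $\langle\xi,\xi\rangle=0$ only for $\xi=0$) which is complete in the norm $\|\xi\|=\|\langle\xi,\xi\rangle\|^{1/2}$. The strong topology on $\mathfrak X$ is generated by the seminorms $\xi\mapsto\varphi(\langle\xi,\xi\rangle)^{1/2}$, $\varphi\in\mathcal M_*^+$; the weak topology is generated by the functionals $\xi\mapsto\varphi(\langle\eta,\xi\rangle)$, $\varphi\in\mathcal M_*$, $\eta\in\mathfrak X$. Let $B=\{\xi\in\mathfrak X:\|\xi\|\le 1\}$. We say that $B$ is strongly (respectively weakly) closed if it is closed in the completion of $\mathfrak X$ for the strong (respectively weak) topology, i.e. if every net in $B$ that is Cauchy for that topology converges in it to an element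 of $B$. The following are equivalent: 1. $B$ is strongly closed; 2. $\mathfrak X$ is an ultraweak direct sum of modules $q_\alpha\mathcal M$: there are projections $(q_\alpha)_{\alpha\in I}$ in $\mathcal M$ such that $\mathfrak X$ is isomorphic, as a right $\mathcal M$-module with $\mathcal M$-valued inner product, to $$\Big\{(x_\alpha)_{\alpha\in I}\ :\ x_\alpha\in q_\alpha\mathcal M,\ \sum_\alpha x_\alpha^*x_\alpha\ \text{converges ultraweakly in }\mathcal M\Big\},\qquad \langle(x_\alpha),(y_\alpha)\rangle=\sum_\alpha x_\alpha^*y_\alpha\ \text{(ultraweak sum)};$$ 3. $\mathfrak X$ is self-dual: $\xi\mapsto\langle\xi,\cdot\,\rangle$ is a bijection from $\mathfrak X$ onto the bounded right $\mathcal M$-module maps $\mathfrak X\to\mathcal M$; 4. $B$ is weakly closed. -/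

import Mathlib

open scoped ComplexOrder RightActions

namespace VonNeumannAlgebra

variable {H : Type*} [NormedAddCommGroup H] [InnerProductSpace ℂ H] [CompleteSpace H]

/-- A von Neumann algebra is closed under multiplication by complex scalars; this makes `↥M` a
complex vector space. -/
instance instSMulMemClass : SMulMemClass (VonNeumannAlgebra H) ℂ (H →L[ℂ] H) where
  smul_mem {M} c _ ha := M.toStarSubalgebra.smul_mem ha c

/-- The predual `M_*`, as a set of linear functionals on `M`: the ultraweakly continuous functionals
`a ↦ ∑ₙ ⟨vₙ, a wₙ⟩` with `∑ₙ ‖vₙ‖² < ∞` and `∑ₙ ‖wₙ‖² < ∞`. -/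
def predual (M : VonNeumannAlgebra H) : Set (M →ₗ[ℂ] ℂ) :=
  {φ | ∃ v w : ℕ → H, Summable (fun n => ‖v n‖ ^ 2) ∧ Summable (fun n => ‖w n‖ ^ 2) ∧
    ∀ a : M, HasSum (fun n => inner ℂ (v n) ((a : H →L[ℂ] H) (w n))) (φ a)}

/-- The positive cone `M_*⁺` of the predual. -/
def predualPos (M : VonNeumannAlgebra H) : Set (M →ₗ[ℂ] ℂ) :=
  {φ | φ ∈ M.predual ∧ ∀ a : M, (a : H →L[ℂ] H).IsPositive → 0 ≤ φ a}

/-- `∑ i, f i = a` in the ultraweak topology of `M`, i.e. the net of finite partial sums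
converges to `a` in the topology generated by the functionals in `M_*`. -/
def HasUltraweakSum (M : VonNeumannAlgebra H) {ι : Type*} (f : ι → M) (a : M) : Prop :=
  ∀ φ ∈ M.predual, HasSum (fun i => φ (f i)) (φ a)

/-- The underlying set of the ultraweak direct sum of the right `M`-modules `q i M`:
families `(f i)` with `f i ∈ q i M` for which `∑ i, (f i)* (f i)` exists in `M`. -/
def ultraweakDirectSum (M : VonNeumannAlgebra H) {ι : Type*} (q : ι → M) : Set (ι → M) :=
  {f | (∀ i, ∃ a : M, f i = q i * a) ∧
    ∃ a : M, M.HasUltraweakSum (fun i => star (f i) * f i) a}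

/-- An `M`-valued inner product on the right `M`-module `X` (the right action being a module
structure over `Mᵐᵒᵖ`, with `x <• a = MulOpposite.op a • x`), inducing the norm of `X`.
A Hilbert C⋆-module over `M` is an `X` with this structure that is complete. -/
class HilbertModule (M : VonNeumannAlgebra H) (X : Type*) [NormedAddCommGroup X]
    [NormedSpace ℂ X] [Module (↥M)ᵐᵒᵖ X] where
  /-- The inner product, conjugate linear in the first and linear in the second variable. -/
  ip : X → X → M
  ip_add_right : ∀ x y z : X, ip x (y + z) = ip x y + ip x z
  ip_smul_right : ∀ (c : ℂ) (x y : X), ip x (c • y) = c • ip x y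
  ip_action_right : ∀ (a : M) (x y : X), ip x (y <• a) = ip x y * a
  star_ip : ∀ x y : X, star (ip y x) = ip x y
  ip_self_pos : ∀ x : X, (ip x x : H →L[ℂ] H).IsPositive
  ip_self_eq_zero : ∀ x : X, ip x x = 0 ↔ x = 0
  norm_eq : ∀ x : X, ‖x‖ = √‖ip x x‖

namespace HilbertModule

variable (M : VonNeumannAlgebra H) (X : Type*) [NormedAddCommGroup X] [NormedSpace ℂ X]
  [Module (↥M)ᵐᵒᵖ X] [HilbertModule M X]

variable {X} in
/-- The seminorm `x ↦ φ(⟨x, x⟩)^(1/2)`; for `φ ∈ M_*⁺` these generate the strong topology. -/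
noncomputable def strongSeminorm (φ : M →ₗ[ℂ] ℂ) (x : X) : ℝ := √(φ (ip x x)).re

/-- The closed unit ball is complete in the strong topology: each filter (equivalently, net) on
the unit ball that is Cauchy for all the strong seminorms converges strongly to a point of the
unit ball. -/
def UnitBallStronglyComplete : Prop :=
  ∀ F : Filter X, F.NeBot → Metric.closedBall (0 : X) 1 ∈ F →
    (∀ φ ∈ M.predualPos,
      Filter.Tendsto (fun p : X × X => strongSeminorm M φ (p.1 - p.2)) (F ×ˢ F) (nhds 0)) →
    ∃ x ∈ Metric.closedBall (0 : X) 1, ∀ φ ∈ M.predualPos,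
      Filter.Tendsto (fun y : X => strongSeminorm M φ (y - x)) F (nhds 0)

/-- The closed unit ball is complete in the weak topology, generated by the functionals
`x ↦ φ(⟨y, x⟩)` with `φ ∈ M_*` and `y ∈ X`: each filter (equivalently, net) on the unit ball along
which all these functionals are Cauchy converges weakly to a point of the unit ball. -/
def UnitBallWeaklyComplete : Prop :=
  ∀ F : Filter X, F.NeBot → Metric.closedBall (0 : X) 1 ∈ F →
    (∀ φ ∈ M.predual, ∀ y : X, Cauchy (F.map fun x : X => φ (ip y x))) →
    ∃ x ∈ Metric.closedBall (0 : X) 1, ∀ φ ∈ M.predual, ∀ y : X,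
      Filter.Tendsto (fun x' : X => φ (ip y x')) F (nhds (φ (ip y x)))

/-- `X` is self-dual: `x ↦ ⟨x, ·⟩` maps `X` bijectively onto the bounded right `M`-module
maps `X → M`. -/
def SelfDual : Prop :=
  ∀ f : X →L[(↥M)ᵐᵒᵖ] M, ∃! x : X, ∀ y : X, f y = ip x y

end HilbertModule

/-- `X` is (isomorphic, as a Hilbert C⋆-module, to) the ultraweak direct sum of modules `q i M`
for some projections `q i` in `M`, the inner product of the latter being the ultraweak sum
`⟨f, g⟩ = ∑ i, (f i)* (g i)`. -/
def HilbertModule.IsPrincipal.{u, v} {H : Type u} [NormedAddCommGroup H] [InnerProductSpace ℂ H]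
    [CompleteSpace H] (M : VonNeumannAlgebra H) (X : Type v) [NormedAddCommGroup X]
    [NormedSpace ℂ X] [Module (↥M)ᵐᵒᵖ X] [HilbertModule M X] : Prop :=
  ∃ (ι : Type v) (q : ι → M), (∀ i, IsStarProjection (q i)) ∧
    ∃ T : X →ₗ[(↥M)ᵐᵒᵖ] (ι → M),
      Set.BijOn T Set.univ (M.ultraweakDirectSum q) ∧
      ∀ x y : X, M.HasUltraweakSum (fun i => star (T x i) * T y i) (ip x y)

end VonNeumannAlgebra

/-!
# Self-dual Hilbert modules over a von Neumann algebra

The four conditions are proved in a cycle.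

*Strongly complete unit ball ⇒ direct sum.* For `x ≠ 0` the vectors `x (⟨x, x⟩ + ε)^(-1/2)` lie in
the unit ball and form a strong Cauchy sequence as `ε` decreases to `0`, because
`⟨x, x⟩ (⟨x, x⟩ + ε)⁻¹` increases and is bounded by `1`. Their limit `z` is the polar part of `x`:
`⟨z, z⟩` is the support projection of `⟨x, x⟩` (`UnitBallStronglyComplete.exists_isStarProjection`).
Zorn's lemma gives a maximal family `e i` of orthogonal vectors whose squares `q i = ⟨e i, e i⟩` are
projections. By Bessel's inequality and completeness `∑ i, e i ⟨e i, y⟩` converges strongly, and by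
maximality its sum is `y`; so `y ↦ (⟨e i, y⟩)` is the required isomorphism.

*Direct sum ⇒ self-dual.* A bounded module map `f` is represented by the vector with coordinates
`f(e i)*`. It is a vector of the direct sum because the partial sums of `∑ i, f(e i) f(e i)*` are
bounded by `‖f‖²`, and it represents `f` everywhere, not only on the span of the `e i`, because of
the inequality `f(y)* f(y) ≤ ‖f‖² ⟨y, y⟩` (`norm_map_apply_sq_le`).

*Self-dual ⇒ weakly complete unit ball.* A weak Cauchy filter on the unit ball has a limit among the
bounded module maps: norm bounded families in `M` whose matrix coefficients converge have ultraweak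
limits in `M` (`exists_ultraweak_limit`).

*Weakly complete ⇒ strongly complete unit ball.* A strong Cauchy filter is weakly Cauchy by the
Cauchy-Schwarz inequality (`exists_norm_apply_ip_le`), and its weak limit is a strong limit since
the strong seminorms are weakly lower semicontinuous.

Operator inequalities `a ≤ b` in `M` are mostly used in the form
`⟨h, a h⟩ ≤ ⟨h, b h⟩` for vectors `h` of the underlying Hilbert space.
-/

namespace VonNeumannAlgebra

open Filter Topology

variable {H : Type*} [NormedAddCommGroup H] [InnerProductSpace ℂ H] [CompleteSpace H]

/-! ### The predual and ultraweak limits -/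

section Predual

variable {M : VonNeumannAlgebra H}

theorem summable_mul_of_summable_sq {ι : Type*} {f g : ι → ℝ} (hf : Summable fun i => f i ^ 2)
    (hg : Summable fun i => g i ^ 2) : Summable fun i => f i * g i :=
  Summable.of_norm_bounded (hf.add hg) fun i => by
    rw [Real.norm_eq_abs, abs_le]
    constructor <;> nlinarith [sq_nonneg (f i + g i), sq_nonneg (f i - g i), sq_nonneg (f i),
      sq_nonneg (g i)]

theorem norm_inner_apply_le (a : M) (v w : H) :
    ‖inner ℂ v ((a : H →L[ℂ] H) w)‖ ≤ ‖a‖ * (‖v‖ * ‖w‖) :=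
  calc ‖inner ℂ v ((a : H →L[ℂ] H) w)‖ ≤ ‖v‖ * ‖(a : H →L[ℂ] H) w‖ := norm_inner_le_norm _ _
    _ ≤ ‖v‖ * (‖(a : H →L[ℂ] H)‖ * ‖w‖) := by gcongr; exact ContinuousLinearMap.le_opNorm _ _
    _ = ‖a‖ * (‖v‖ * ‖w‖) := by rw [← mul_assoc, mul_comm ‖v‖, mul_assoc]; rfl

omit [InnerProductSpace ℂ H] [CompleteSpace H] in
theorem summable_norm_mul_norm {v w : ℕ → H} (hv : Summable fun n => ‖v n‖ ^ 2)
    (hw : Summable fun n => ‖w n‖ ^ 2) : Summable fun n => ‖v n‖ * ‖w n‖ :=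
  summable_mul_of_summable_sq hv hw

theorem summable_inner_apply (a : M) {v w : ℕ → H} (hv : Summable fun n => ‖v n‖ ^ 2)
    (hw : Summable fun n => ‖w n‖ ^ 2) :
    Summable fun n => inner ℂ (v n) ((a : H →L[ℂ] H) (w n)) :=
  Summable.of_norm_bounded ((summable_norm_mul_norm hv hw).mul_left ‖a‖)
    fun n => norm_inner_apply_le a (v n) (w n)

/-- Square-summable sequences of vectors define elements of the predual. -/
theorem exists_mem_predual (M : VonNeumannAlgebra H) {v w : ℕ → H}
    (hv : Summable fun n => ‖v n‖ ^ 2) (hw : Summable fun n => ‖w n‖ ^ 2) :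
    ∃ φ ∈ M.predual, ∀ a : M, HasSum (fun n => inner ℂ (v n) ((a : H →L[ℂ] H) (w n))) (φ a) :=
  ⟨{ toFun := fun a => ∑' n, inner ℂ (v n) ((a : H →L[ℂ] H) (w n))
     map_add' := fun a b => by
      rw [← (summable_inner_apply a hv hw).tsum_add (summable_inner_apply b hv hw)]
      simp
     map_smul' := fun c a => by
      rw [RingHom.id_apply, smul_eq_mul, ← tsum_mul_left]
      simp },
    ⟨v, w, hv, hw, fun a => (summable_inner_apply a hv hw).hasSum⟩,
    fun a => (summable_inner_apply a hv hw).hasSum⟩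

theorem exists_mem_predualPos (M : VonNeumannAlgebra H) {w : ℕ → H}
    (hw : Summable fun n => ‖w n‖ ^ 2) :
    ∃ φ ∈ M.predualPos, ∀ a : M,
      HasSum (fun n => inner ℂ (w n) ((a : H →L[ℂ] H) (w n))) (φ a) := by
  obtain ⟨φ, hφ, h⟩ := exists_mem_predual M hw hw
  exact ⟨φ, ⟨hφ, fun a ha => (h a).nonneg fun n => ha.inner_nonneg_right _⟩, h⟩

/-- The vector functional `a ↦ ⟨h, a k⟩` belongs to the predual. -/
theorem exists_mem_predual_eq_inner (M : VonNeumannAlgebra H) (h k : H) :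
    ∃ φ ∈ M.predual, ∀ a : M, φ a = inner ℂ h ((a : H →L[ℂ] H) k) := by
  have aux (x : H) : Summable fun n : ℕ => ‖(Pi.single 0 x : ℕ → H) n‖ ^ 2 :=
    (hasSum_single 0 fun n hn => by simp [hn]).summable
  obtain ⟨φ, hφ, e⟩ := exists_mem_predual M (aux h) (aux k)
  refine ⟨φ, hφ, fun a => (e a).unique ?_⟩
  simpa using hasSum_single (f := fun n : ℕ => inner ℂ ((Pi.single 0 h : ℕ → H) n)
    ((a : H →L[ℂ] H) ((Pi.single 0 k : ℕ → H) n))) 0 fun n hn => by simp [hn]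

/-- The vector state `a ↦ ⟨h, a h⟩` belongs to the positive cone of the predual. -/
theorem exists_mem_predualPos_eq_inner (M : VonNeumannAlgebra H) (h : H) :
    ∃ φ ∈ M.predualPos, ∀ a : M, φ a = inner ℂ h ((a : H →L[ℂ] H) h) := by
  obtain ⟨φ, hφ, e⟩ := exists_mem_predual_eq_inner M h h
  exact ⟨φ, ⟨hφ, fun a ha => by rw [e]; exact ha.inner_nonneg_right _⟩, e⟩

theorem ext_inner {a b : M} (h : ∀ u v : H,
    inner ℂ u ((a : H →L[ℂ] H) v) = inner ℂ u ((b : H →L[ℂ] H) v)) : a = b :=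
  Subtype.ext <| ContinuousLinearMap.ext fun v => ext_inner_left ℂ fun u => h u v

/-- The predual separates the points of `M`. -/
theorem ext_predual {a b : M} (h : ∀ φ ∈ M.predual, φ a = φ b) : a = b :=
  ext_inner fun u v => by
    obtain ⟨φ, hφ, e⟩ := exists_mem_predual_eq_inner M u v
    rw [← e, ← e, h φ hφ]

/-- The predual is stable under the involution `φ ↦ φ*`, where `φ*(a)` is the conjugate
of `φ(a*)`. -/
theorem exists_mem_predual_star {φ : M →ₗ[ℂ] ℂ} (hφ : φ ∈ M.predual) :
    ∃ ψ ∈ M.predual, ∀ a : M, φ (star a) = star (ψ a) := by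
  obtain ⟨v, w, hv, hw, h⟩ := hφ
  obtain ⟨ψ, hψ, h'⟩ := exists_mem_predual M hw hv
  refine ⟨ψ, hψ, fun a => (h (star a)).unique ?_⟩
  have := (h' a).star
  convert! this using 2 with n
  change inner ℂ (v n) (star (a : H →L[ℂ] H) (w n)) = _
  rw [ContinuousLinearMap.star_eq_adjoint, ContinuousLinearMap.adjoint_inner_right]
  exact (inner_conj_symm _ _).symm

theorem predualPos_mono {φ : M →ₗ[ℂ] ℂ} (hφ : φ ∈ M.predualPos) {a b : M} (h : a ≤ b) :
    φ a ≤ φ b := by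
  have := hφ.2 (b - a) h
  rwa [map_sub, sub_nonneg] at this

theorem norm_apply_sq (a : M) (h : H) :
    inner ℂ h (((star a * a : M) : H →L[ℂ] H) h) = ((‖(a : H →L[ℂ] H) h‖ ^ 2 : ℝ) : ℂ) := by
  change inner ℂ h ((star (a : H →L[ℂ] H)) ((a : H →L[ℂ] H) h)) = _
  rw [ContinuousLinearMap.star_eq_adjoint, ContinuousLinearMap.adjoint_inner_right,
    inner_self_eq_norm_sq_to_K]
  simp

theorem star_mul_self_isPositive (a : M) : ((star a * a : M) : H →L[ℂ] H).IsPositive :=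
  (ContinuousLinearMap.nonneg_iff_isPositive _).1 (star_mul_self_nonneg (a : H →L[ℂ] H))

/-- An operator commuting with the commutant of `M` belongs to `M`. -/
theorem mem_of_forall_commute {a : H →L[ℂ] H} (h : ∀ b ∈ M.commutant, b * a = a * b) : a ∈ M := by
  rw [← commutant_commutant M, mem_commutant_iff]
  exact h

/-- A norm bounded family in `M` whose matrix coefficients converge has an ultraweak limit
in `M`. -/
theorem exists_ultraweak_limit {α : Type*} {l : Filter α} [l.NeBot] {a : α → M} {C : ℝ}
    (hC : ∀ᶠ j in l, ‖a j‖ ≤ C)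
    (h : ∀ u v : H, ∃ z, Tendsto (fun j => inner ℂ u ((a j : H →L[ℂ] H) v)) l (𝓝 z)) :
    ∃ b : M, ‖b‖ ≤ C ∧ ∀ φ ∈ M.predual, Tendsto (fun j => φ (a j)) l (𝓝 (φ b)) := by
  have hC0 : 0 ≤ C := by
    obtain ⟨j, hj⟩ := hC.exists
    exact (norm_nonneg _).trans hj
  choose B hB using h
  have bound (u v : H) : ‖B u v‖ ≤ C * ‖u‖ * ‖v‖ := by
    refine le_of_tendsto (hB u v).norm (hC.mono fun j hj => (norm_inner_apply_le _ _ _).trans ?_)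
    rw [mul_assoc]
    gcongr
  let S : H →L⋆[ℂ] H →L[ℂ] ℂ := LinearMap.mkContinuous₂
    (LinearMap.mk₂'ₛₗ (starRingEnd ℂ) (RingHom.id ℂ) B
      (fun u u' v => tendsto_nhds_unique (hB _ _)
        (((hB u v).add (hB u' v)).congr fun j => by rw [inner_add_left]))
      (fun c u v => tendsto_nhds_unique (hB _ _)
        (((hB u v).const_mul _).congr fun j => by rw [inner_smul_left]))
      (fun u v v' => tendsto_nhds_unique (hB _ _)
        (((hB u v).add (hB u v')).congr fun j => by rw [map_add, inner_add_right]))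
      (fun c u v => tendsto_nhds_unique (hB _ _)
        (((hB u v).const_mul _).congr fun j => by
          rw [map_smul, inner_smul_right, RingHom.id_apply]))) C bound
  -- The bilinear form is represented in its first slot; the adjoint moves it to the second.
  let T : H →L[ℂ] H := star (InnerProductSpace.continuousLinearMapOfBilin S)
  have hT (u v : H) : inner ℂ u (T v) = B u v := by
    change inner ℂ u (star (InnerProductSpace.continuousLinearMapOfBilin S) v) = B u v
    rw [ContinuousLinearMap.star_eq_adjoint, ContinuousLinearMap.adjoint_inner_right,
      InnerProductSpace.continuousLinearMapOfBilin_apply]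
    rfl
  have hTM : T ∈ M := by
    refine mem_of_forall_commute fun b hb => ContinuousLinearMap.ext fun v =>
      ext_inner_left ℂ fun u => ?_
    change inner ℂ u (b (T v)) = inner ℂ u (T (b v))
    rw [← ContinuousLinearMap.adjoint_inner_left, hT, hT]
    refine tendsto_nhds_unique (hB _ _) ((hB u (b v)).congr fun j => ?_)
    rw [ContinuousLinearMap.adjoint_inner_left]
    have := mem_commutant_iff.1 hb (a j) (a j).2
    exact congrArg (inner ℂ u) (congrArg (fun T : H →L[ℂ] H => T v) this)
  refine ⟨⟨T, hTM⟩, ?_, ?_⟩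
  · refine ContinuousLinearMap.opNorm_le_bound _ hC0 fun v => ?_
    by_cases hv : ‖T v‖ = 0
    · change ‖T v‖ ≤ _
      rw [hv]
      positivity
    have := bound (T v) v
    rw [← hT, inner_self_eq_norm_sq_to_K, norm_pow, RCLike.norm_ofReal, abs_norm] at this
    have h0 : 0 < ‖T v‖ := lt_of_le_of_ne (norm_nonneg _) (Ne.symm hv)
    change ‖T v‖ ≤ C * ‖v‖
    exact le_of_mul_le_mul_left (by linarith) h0
  · rintro φ ⟨v, w, hv, hw, hφ⟩
    have := tendsto_tsum_of_dominated_convergence (𝓕 := l)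
      (f := fun j n => inner ℂ (v n) ((a j : H →L[ℂ] H) (w n)))
      (g := fun n => inner ℂ (v n) (T (w n))) ((summable_norm_mul_norm hv hw).mul_left C)
      (fun n => by simpa only [hT] using hB (v n) (w n))
      (hC.mono fun j hj n => (norm_inner_apply_le _ _ _).trans (by gcongr))
    rw [(hφ ⟨T, hTM⟩).tsum_eq] at this
    exact this.congr fun j => (hφ (a j)).tsum_eq

end Predual

/-! ### Functional calculus in a von Neumann algebra -/

section FunctionalCalculus

variable {M : VonNeumannAlgebra H}

/-- `M` is stable under the continuous functional calculus. -/
theorem cfc_mem (a : M) (ha : IsSelfAdjoint (a : H →L[ℂ] H)) (f : ℝ → ℝ) :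
    cfc f (a : H →L[ℂ] H) ∈ M :=
  mem_of_forall_commute fun _ hb =>
    ((ha.commute_cfc (𝕜 := ℝ) (mem_commutant_iff.1 hb a a.2) f).eq).symm

theorem continuous_sqrt_abs_add (ε : ℝ) : Continuous fun t : ℝ => √(|t| + ε) := by fun_prop

theorem continuous_inv_sqrt_abs_add {ε : ℝ} (hε : 0 < ε) :
    Continuous fun t : ℝ => (√(|t| + ε))⁻¹ :=
  (continuous_sqrt_abs_add ε).inv₀ fun t => by positivity

/-- For a positive `a`, the element `(a + ε)^(-1/2)` with inverse `(a + ε)^(1/2)`. -/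
theorem exists_sqrt_add (a : M) (ha : (a : H →L[ℂ] H).IsPositive) {ε : ℝ} (hε : 0 < ε) :
    ∃ r s : M, star r = r ∧ star s = s ∧ r * s = 1 ∧ s * s = a + (ε : ℂ) • 1 := by
  have hsa := ha.isSelfAdjoint
  have hc := continuous_sqrt_abs_add ε
  have hc' := continuous_inv_sqrt_abs_add hε
  have hsp (t : ℝ) (ht : t ∈ spectrum ℝ (a : H →L[ℂ] H)) : 0 ≤ t :=
    spectrum_nonneg_of_nonneg ((ContinuousLinearMap.nonneg_iff_isPositive _).2 ha) ht
  refine ⟨⟨_, cfc_mem a hsa fun t => (√(|t| + ε))⁻¹⟩, ⟨_, cfc_mem a hsa fun t => √(|t| + ε)⟩,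
    Subtype.ext ?_, Subtype.ext ?_, Subtype.ext ?_, Subtype.ext ?_⟩
  · exact (cfc_predicate (p := IsSelfAdjoint) _ _).star_eq
  · exact (cfc_predicate (p := IsSelfAdjoint) _ _).star_eq
  · change cfc _ _ * cfc _ _ = (1 : H →L[ℂ] H)
    rw [← cfc_mul _ _ _ hc'.continuousOn hc.continuousOn, ← cfc_const_one ℝ (a : H →L[ℂ] H)]
    refine cfc_congr fun t _ => inv_mul_cancel₀ ?_
    positivity
  · change cfc _ _ * cfc _ _ = (a : H →L[ℂ] H) + (ε : ℂ) • 1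
    rw [← cfc_mul _ _ _ hc.continuousOn hc.continuousOn]
    have : cfc (fun t : ℝ => t + ε) (a : H →L[ℂ] H) = (a : H →L[ℂ] H) + (ε : ℂ) • 1 := by
      rw [cfc_add_const ε (fun t : ℝ => t) (a : H →L[ℂ] H), cfc_id' ℝ (a : H →L[ℂ] H),
        Algebra.algebraMap_eq_smul_one]
      rfl
    rw [← this]
    refine cfc_congr fun t ht => ?_
    change √(|t| + ε) * √(|t| + ε) = t + ε
    rw [Real.mul_self_sqrt (by positivity), abs_of_nonneg (hsp t ht)]

/-- For a positive `a` there are self-adjoint `r n` in `M`, namely `(a + 1 / (n + 1))^(-1/2)`, such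
that `r n * a * r n` is an increasing sequence of contractions which acts in the limit as
a unit for `a`. -/
theorem exists_regularization (a : M) (ha : (a : H →L[ℂ] H).IsPositive) :
    ∃ r : ℕ → M, (∀ n, star (r n) = r n) ∧ (∀ n, r n * a * r n ≤ 1) ∧
      (∀ m n, m ≤ n → (r n - r m) * a * (r n - r m) ≤ r n * a * r n - r m * a * r m) ∧
      (∀ n, r n * a * r n = a * (r n * r n)) ∧
      Tendsto (fun n => r n * a * r n * a) atTop (𝓝 a) := by
  have hsa := ha.isSelfAdjoint
  have hsp (t : ℝ) (ht : t ∈ spectrum ℝ (a : H →L[ℂ] H)) : 0 ≤ t :=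
    spectrum_nonneg_of_nonneg ((ContinuousLinearMap.nonneg_iff_isPositive _).2 ha) ht
  -- The absolute value makes `f n` continuous on the whole line; the spectrum is nonnegative.
  let f (n : ℕ) (t : ℝ) : ℝ := (√(|t| + 1 / (n + 1 : ℝ)))⁻¹
  have hf (n : ℕ) : Continuous (f n) := continuous_inv_sqrt_abs_add (by positivity)
  have hf0 (n : ℕ) (t : ℝ) : 0 ≤ f n t := by positivity
  have hf2 (n : ℕ) (t : ℝ) : f n t * f n t = (|t| + 1 / (n + 1 : ℝ))⁻¹ := by
    rw [← mul_inv, Real.mul_self_sqrt (by positivity)]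
  have hid : cfc (fun t : ℝ => t) (a : H →L[ℂ] H) = a := cfc_id' ℝ (a : H →L[ℂ] H)
  have hb (g : ℝ → ℝ) (hg : Continuous g) :
      cfc g (a : H →L[ℂ] H) * a * cfc g (a : H →L[ℂ] H) =
        cfc (fun t => g t * t * g t) (a : H →L[ℂ] H) := by
    nth_rw 2 [← hid]
    rw [← cfc_mul g (fun t => t) _ hg.continuousOn, ← cfc_mul (fun t => g t * t) g _
      (by fun_prop) hg.continuousOn]
  let r (n : ℕ) : M := ⟨cfc (f n) (a : H →L[ℂ] H), cfc_mem a hsa (f n)⟩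
  have hr (n : ℕ) : ((r n * a * r n : M) : H →L[ℂ] H) =
      cfc (fun t => f n t * t * f n t) (a : H →L[ℂ] H) := hb _ (hf n)
  refine ⟨r, fun n => Subtype.ext (cfc_predicate (p := IsSelfAdjoint) _ _).star_eq,
    fun n => ?_, fun m n hmn => ?_, fun n => ?_, ?_⟩
  · change ((r n * a * r n : M) : H →L[ℂ] H) ≤ (1 : H →L[ℂ] H)
    rw [hr]
    refine cfc_le_one _ _ fun t ht => ?_
    have h0 := hsp t ht
    rw [mul_right_comm, hf2, abs_of_nonneg h0, inv_mul_le_one₀ (by positivity)]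
    have : (0 : ℝ) < 1 / (n + 1 : ℝ) := by positivity
    linarith
  · change (cfc (f n) (a : H →L[ℂ] H) - cfc (f m) (a : H →L[ℂ] H)) * a *
      (cfc (f n) (a : H →L[ℂ] H) - cfc (f m) (a : H →L[ℂ] H)) ≤
      ((r n * a * r n : M) : H →L[ℂ] H) - ((r m * a * r m : M) : H →L[ℂ] H)
    rw [hr, hr, ← cfc_sub _ _ _ (hf n).continuousOn (hf m).continuousOn, hb _ (by fun_prop),
      ← cfc_sub _ _ _ (by fun_prop) (by fun_prop)]
    refine cfc_mono (fun t ht => ?_) (by fun_prop) (by fun_prop)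
    have h0 := hsp t ht
    have hle : f m t ≤ f n t := by
      dsimp only [f]
      gcongr
    nlinarith [mul_nonneg (mul_nonneg h0 (hf0 m t)) (sub_nonneg.2 hle)]
  · have hcomm : cfc (f n) (a : H →L[ℂ] H) * a = a * cfc (f n) (a : H →L[ℂ] H) :=
      (hsa.commute_cfc (𝕜 := ℝ) (Commute.refl _) (f n)).eq
    have : r n * a = a * r n := Subtype.ext hcomm
    rw [this, mul_assoc]
  · rw [tendsto_iff_norm_sub_tendsto_zero]
    refine squeeze_zero (fun _ => norm_nonneg _) (fun n => ?_)
      tendsto_one_div_add_atTop_nhds_zero_nat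
    change ‖((r n * a * r n : M) : H →L[ℂ] H) * a - a‖ ≤ _
    have : ((r n * a * r n : M) : H →L[ℂ] H) * a - a =
        cfc (fun t => f n t * t * f n t * t - t) (a : H →L[ℂ] H) := by
      rw [cfc_sub _ _ _ (by fun_prop) (by fun_prop), cfc_mul _ _ _ (by fun_prop) (by fun_prop),
        hid, hr]
    rw [this]
    refine norm_cfc_le (by positivity) fun t ht => ?_
    have h0 := hsp t ht
    have hp : (0 : ℝ) < 1 / (n + 1 : ℝ) := by positivity
    have : f n t * t * f n t * t - t = - (1 / (n + 1 : ℝ) * (t / (t + 1 / (n + 1 : ℝ)))) := by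
      rw [mul_right_comm (f n t), hf2, abs_of_nonneg h0]
      field_simp
      ring
    rw [this, norm_neg, Real.norm_of_nonneg (by positivity)]
    refine mul_le_of_le_one_right hp.le ((div_le_one (by positivity)).2 ?_)
    linarith

end FunctionalCalculus

/-! ### Ultraweak sums of positive elements -/

section UltraweakSum

variable {M : VonNeumannAlgebra H} {ι : Type*}

theorem summable_predualPos {φ : M →ₗ[ℂ] ℂ} (hφ : φ ∈ M.predualPos) {x : ι → M} {a : M}
    (ha : ∀ s : Finset ι, ∑ i ∈ s, star (x i) * x i ≤ a) :
    Summable fun i => φ (star (x i) * x i) := by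
  have h0 (i : ι) : 0 ≤ φ (star (x i) * x i) := hφ.2 _ (star_mul_self_isPositive _)
  have hre (i : ι) : ((φ (star (x i) * x i)).re : ℂ) = φ (star (x i) * x i) :=
    (Complex.eq_re_of_ofReal_le (r := 0) (by simpa using h0 i)).symm
  have : Summable fun i => (φ (star (x i) * x i)).re := by
    refine summable_of_sum_le (c := (φ a).re) (fun i => (Complex.nonneg_iff.1 (h0 i)).1) fun s => ?_
    rw [← Complex.re_sum, ← map_sum]
    exact (Complex.le_def.1 (predualPos_mono hφ (ha s))).1
  have h2 := (Complex.hasSum_ofReal.2 this.hasSum).summable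
  simpa only [hre] using h2

theorem sum_le_of_hasUltraweakSum {x : ι → M} {a : M}
    (ha : M.HasUltraweakSum (fun i => star (x i) * x i) a) (s : Finset ι) :
    ∑ i ∈ s, star (x i) * x i ≤ a := by
  change ((a - ∑ i ∈ s, star (x i) * x i : M) : H →L[ℂ] H) |>.IsPositive
  rw [ContinuousLinearMap.isPositive_iff_complex]
  intro u
  obtain ⟨φ, hφ, e⟩ := exists_mem_predualPos_eq_inner M u
  have h : 0 ≤ φ (a - ∑ i ∈ s, star (x i) * x i) := by
    rw [map_sub, map_sum, sub_nonneg]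
    exact sum_le_hasSum s (fun i _ => hφ.2 _ (star_mul_self_isPositive _)) (ha φ hφ.1)
  rw [e, ← inner_conj_symm] at h
  have h' := Complex.nonneg_iff.1 h
  rw [Complex.conj_re, Complex.conj_im, zero_eq_neg] at h'
  exact ⟨Complex.ext rfl h'.2.symm, h'.1⟩

/-- If the finite partial sums of `∑ i, (x i)* (x i)` are norm bounded, the sum converges
ultraweakly in `M`. -/
theorem exists_hasUltraweakSum {x : ι → M} {C : ℝ}
    (hC : ∀ s : Finset ι, ‖∑ i ∈ s, star (x i) * x i‖ ≤ C) :
    ∃ a : M, M.HasUltraweakSum (fun i => star (x i) * x i) a := by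
  have e (u v : H) (i : ι) : inner ℂ u (((star (x i) * x i : M) : H →L[ℂ] H) v) =
      inner ℂ ((x i : H →L[ℂ] H) u) ((x i : H →L[ℂ] H) v) := by
    change inner ℂ u ((star (x i : H →L[ℂ] H)) _) = _
    rw [ContinuousLinearMap.star_eq_adjoint, ContinuousLinearMap.adjoint_inner_right]
    rfl
  have hadd (u v : H) (s : Finset ι) :
      inner ℂ u (((∑ i ∈ s, star (x i) * x i : M) : H →L[ℂ] H) v) =
        ∑ i ∈ s, inner ℂ ((x i : H →L[ℂ] H) u) ((x i : H →L[ℂ] H) v) := by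
    obtain ⟨φ, hφ, h⟩ := exists_mem_predual_eq_inner M u v
    rw [← h, map_sum]
    simp only [h, e]
  have hsq (u : H) : Summable fun i => ‖(x i : H →L[ℂ] H) u‖ ^ 2 := by
    refine summable_of_sum_le (c := C * (‖u‖ * ‖u‖)) (fun i => by positivity) fun s => ?_
    have h1 := (norm_inner_apply_le (∑ i ∈ s, star (x i) * x i) u u).trans
      (mul_le_mul_of_nonneg_right (hC s) (by positivity))
    refine le_trans ?_ ((Complex.re_le_norm _).trans h1)
    rw [hadd, Complex.re_sum]
    exact Finset.sum_le_sum fun i _ => (inner_self_eq_norm_sq (𝕜 := ℂ) _).ge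
  obtain ⟨a, -, h⟩ := exists_ultraweak_limit (l := atTop)
    (a := fun s : Finset ι => ∑ i ∈ s, star (x i) * x i) (Eventually.of_forall hC) fun u v => by
      have : Summable fun i => inner ℂ ((x i : H →L[ℂ] H) u) ((x i : H →L[ℂ] H) v) :=
        Summable.of_norm_bounded (summable_mul_of_summable_sq (hsq u) (hsq v))
          fun i => norm_inner_le_norm _ _
      exact ⟨_, this.hasSum.congr fun s => (hadd u v s).symm⟩
  exact ⟨a, fun φ hφ => (h φ hφ).congr fun s => map_sum _ _ _⟩

end UltraweakSum

namespace HilbertModule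

/-! ### Inequalities in Hilbert modules -/

section Basic

variable {M : VonNeumannAlgebra H} {X : Type*} [NormedAddCommGroup X] [NormedSpace ℂ X]
  [Module (↥M)ᵐᵒᵖ X] [HilbertModule M X]

theorem ip_add_left (x y z : X) : (ip (x + y) z : M) = ip x z + ip y z := by
  rw [← star_ip, ip_add_right, star_add, star_ip, star_ip]

theorem ip_zero_right (x : X) : (ip x 0 : M) = 0 := by
  have := ip_add_right (M := M) x 0 0
  rwa [add_zero, left_eq_add] at this

theorem ip_zero_left (x : X) : (ip 0 x : M) = 0 := by
  rw [← star_ip, ip_zero_right, star_zero]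

theorem ip_sub_right (x y z : X) : (ip x (y - z) : M) = ip x y - ip x z := by
  rw [eq_sub_iff_add_eq, ← ip_add_right, sub_add_cancel]

theorem ip_sub_left (x y z : X) : (ip (x - y) z : M) = ip x z - ip y z := by
  rw [eq_sub_iff_add_eq, ← ip_add_left, sub_add_cancel]

theorem ip_action_left (a : M) (x y : X) : (ip (x <• a) y : M) = star a * ip x y := by
  rw [← star_ip, ip_action_right, star_mul, star_ip]

theorem ip_smul_left (c : ℂ) (x y : X) : (ip (c • x) y : M) = star c • ip x y := by
  rw [← star_ip, ip_smul_right, star_smul, star_ip]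

theorem ip_sum_right {ι : Type*} (s : Finset ι) (x : X) (y : ι → X) :
    (ip x (∑ i ∈ s, y i) : M) = ∑ i ∈ s, ip x (y i) := by
  classical
  induction s using Finset.induction_on with
  | empty => simp [ip_zero_right]
  | insert i s hi ih => rw [Finset.sum_insert hi, Finset.sum_insert hi, ip_add_right, ih]

theorem ip_sum_left {ι : Type*} (s : Finset ι) (x : ι → X) (y : X) :
    (ip (∑ i ∈ s, x i) y : M) = ∑ i ∈ s, ip (x i) y := by
  rw [← star_ip, ip_sum_right, star_sum]
  simp only [star_ip]

variable (M) in
theorem ext_ip {x y : X} (h : ∀ z : X, (ip z x : M) = ip z y) : x = y := by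
  rw [← sub_eq_zero, ← ip_self_eq_zero (M := M), ip_sub_right, h, sub_self]

/-- Complex scalars act on `X` through `M`. -/
theorem action_smul_one (c : ℂ) (x : X) : x <• (c • 1 : M) = c • x :=
  ext_ip M fun z => by rw [ip_action_right, ip_smul_right, mul_smul_comm, mul_one]

variable (M) in
theorem norm_ip_self (x : X) : ‖(ip x x : M)‖ = ‖x‖ ^ 2 := by
  rw [norm_eq (M := M) x, Real.sq_sqrt (norm_nonneg _)]

theorem norm_sq_le_of_ip_self_le {x : X} {a : M} (h : ip x x ≤ a) : ‖x‖ ^ 2 ≤ ‖a‖ := by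
  rw [← norm_ip_self M]
  exact CStarAlgebra.norm_le_norm_of_nonneg_of_le (A := H →L[ℂ] H)
    ((ContinuousLinearMap.nonneg_iff_isPositive _).2 (ip_self_pos x)) h

theorem norm_le_one_of_ip_self_le_one {x : X} (h : ip x x ≤ (1 : M)) : ‖x‖ ≤ 1 := by
  have h1 : ‖(1 : M)‖ ≤ 1 := ContinuousLinearMap.opNorm_le_bound _ zero_le_one fun v => by simp
  have := (norm_sq_le_of_ip_self_le h).trans h1
  exact (sq_le_one_iff₀ (norm_nonneg _)).1 this

theorem re_inner_ip_self_nonneg (x : X) (h : H) :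
    0 ≤ (inner ℂ h (((ip x x : M) : H →L[ℂ] H) h)).re :=
  (ip_self_pos x).re_inner_nonneg_right h

theorem re_inner_ip_self_le (x : X) (h : H) :
    (inner ℂ h (((ip x x : M) : H →L[ℂ] H) h)).re ≤ ‖x‖ ^ 2 * ‖h‖ ^ 2 := by
  rw [← norm_ip_self M x, sq ‖h‖]
  exact (Complex.re_le_norm _).trans (norm_inner_apply_le _ _ _)

/-- The Cauchy-Schwarz inequality `⟨z, y⟩⟨y, z⟩ ≤ ‖y‖² ⟨z, z⟩`, tested against vectors. -/
theorem norm_ip_apply_sq_le (y z : X) (h : H) :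
    ‖((ip y z : M) : H →L[ℂ] H) h‖ ^ 2 ≤
      ‖y‖ ^ 2 * (inner ℂ h (((ip z z : M) : H →L[ℂ] H) h)).re := by
  by_cases hy : y = 0
  · simp [hy, ip_zero_left]
  have hN : 0 < ‖y‖ ^ 2 := by positivity
  set t : ℝ := (‖y‖ ^ 2)⁻¹ with ht
  set b : M := ip y z with hb
  -- Expand the square of `z - y (t b)` with `t = ‖y‖⁻²`, the optimal multiple.
  have key := re_inner_ip_self_nonneg (M := M) (z - y <• ((t : ℂ) • b)) h
  have hyy := re_inner_ip_self_le (M := M) y ((b : H →L[ℂ] H) h)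
  have e : (ip (z - y <• ((t : ℂ) • b)) (z - y <• ((t : ℂ) • b)) : M) =
      ip z z - (t : ℂ) • (star b * b) - (t : ℂ) • (star b * b) +
        ((t : ℂ) * t) • (star b * ip y y * b) := by
    rw [ip_sub_left, ip_sub_right, ip_sub_right, ip_action_left, ip_action_left, ip_action_right,
      ip_action_right, ← star_ip z y, ← hb]
    simp only [mul_smul_comm, star_smul, smul_mul_assoc, smul_smul, Complex.star_def,
      Complex.conj_ofReal, mul_assoc]
    abel
  have e2 : inner ℂ h (((star b * ip y y * b : M) : H →L[ℂ] H) h) =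
      inner ℂ ((b : H →L[ℂ] H) h) (((ip y y : M) : H →L[ℂ] H) ((b : H →L[ℂ] H) h)) := by
    change inner ℂ h ((star (b : H →L[ℂ] H)) _) = _
    rw [ContinuousLinearMap.star_eq_adjoint, ContinuousLinearMap.adjoint_inner_right]
    rfl
  have e3 : (inner ℂ h (((ip (z - y <• ((t : ℂ) • b)) (z - y <• ((t : ℂ) • b)) : M) :
      H →L[ℂ] H) h)).re = (inner ℂ h (((ip z z : M) : H →L[ℂ] H) h)).re
        - 2 * t * ‖(b : H →L[ℂ] H) h‖ ^ 2 + t * t * (inner ℂ ((b : H →L[ℂ] H) h)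
          (((ip y y : M) : H →L[ℂ] H) ((b : H →L[ℂ] H) h))).re := by
    have e1 := norm_apply_sq b h
    rw [e]
    change (inner ℂ h (((ip z z : M) : H →L[ℂ] H) h - (t : ℂ) • ((star b * b : M) : H →L[ℂ] H) h
      - (t : ℂ) • ((star b * b : M) : H →L[ℂ] H) h
      + ((t : ℂ) * t) • ((star b * ip y y * b : M) : H →L[ℂ] H) h)).re = _
    rw [inner_add_right, inner_sub_right, inner_sub_right, inner_smul_right, inner_smul_right,
      e1, e2, ← Complex.ofReal_mul, ← Complex.ofReal_mul, Complex.add_re, Complex.sub_re,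
      Complex.sub_re, Complex.ofReal_re, Complex.re_ofReal_mul]
    ring
  rw [e3] at key
  have ht0 : 0 < t := inv_pos.2 hN
  have h1 : t * t * (inner ℂ ((b : H →L[ℂ] H) h)
      (((ip y y : M) : H →L[ℂ] H) ((b : H →L[ℂ] H) h))).re ≤ t * ‖(b : H →L[ℂ] H) h‖ ^ 2 :=
    calc _ ≤ t * t * (‖y‖ ^ 2 * ‖(b : H →L[ℂ] H) h‖ ^ 2) := by gcongr
      _ = t * ‖(b : H →L[ℂ] H) h‖ ^ 2 * (t * ‖y‖ ^ 2) := by ring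
      _ = _ := by rw [ht, inv_mul_cancel₀ hN.ne', mul_one]
  have h2 : t * ‖(b : H →L[ℂ] H) h‖ ^ 2 ≤ (inner ℂ h (((ip z z : M) : H →L[ℂ] H) h)).re := by
    linarith
  rwa [ht, inv_mul_le_iff₀ hN] at h2

theorem norm_ip_le (y z : X) : ‖(ip y z : M)‖ ≤ ‖y‖ * ‖z‖ :=
  ContinuousLinearMap.opNorm_le_bound _ (by positivity) fun h => by
    refine le_of_sq_le_sq ?_ (by positivity)
    refine (norm_ip_apply_sq_le (M := M) y z h).trans ?_
    rw [mul_pow, mul_pow, mul_assoc]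
    gcongr
    exact re_inner_ip_self_le z h

/-- A bounded module map `f` satisfies `f(y)* f(y) ≤ C² ⟨y, y⟩`, tested against vectors. -/
theorem norm_map_apply_sq_le (f : X → M) {C : ℝ} (hC : ∀ y, ‖f y‖ ≤ C * ‖y‖)
    (hf : ∀ (y : X) (a : M), f (y <• a) = f y * a) (y : X) (h : H) :
    ‖(f y : H →L[ℂ] H) h‖ ^ 2 ≤ C ^ 2 * (inner ℂ h (((ip y y : M) : H →L[ℂ] H) h)).re := by
  -- Factor `y = (y r) s` with `r = (⟨y, y⟩ + ε)^(-1/2)` and `s = r⁻¹`, where `‖y r‖ ≤ 1`.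
  have key (ε : ℝ) (hε : 0 < ε) : ‖(f y : H →L[ℂ] H) h‖ ^ 2 ≤
      C ^ 2 * ((inner ℂ h (((ip y y : M) : H →L[ℂ] H) h)).re + ε * ‖h‖ ^ 2) := by
    obtain ⟨r, s, hr, hs, hrs, hss⟩ := exists_sqrt_add (ip y y : M) (ip_self_pos y) hε
    have hsr : s * r = 1 := by rw [← hr, ← hs, ← star_mul, hrs, star_one]
    have hyr : ‖y <• r‖ ≤ 1 := by
      refine norm_le_one_of_ip_self_le_one (M := M) ?_
      have e : (1 : M) - ip (y <• r) (y <• r) =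
          star ((Real.sqrt ε : ℂ) • r) * ((Real.sqrt ε : ℂ) • r) := by
        have : (ip y y : M) = s * s - (ε : ℂ) • 1 := by rw [hss, add_sub_cancel_right]
        rw [ip_action_left, ip_action_right, this, hr, star_smul, hr, sub_mul, mul_sub,
          mul_assoc s s r, hsr, mul_one, hrs, sub_sub_cancel, smul_mul_smul_comm, smul_mul_assoc,
          one_mul, mul_smul_comm, Complex.star_def, Complex.conj_ofReal, ← Complex.ofReal_mul,
          Real.mul_self_sqrt hε.le]
      change (((1 : M) - ip (y <• r) (y <• r) : M) : H →L[ℂ] H).IsPositive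
      rw [e]
      exact star_mul_self_isPositive _
    have hfy : f y = f (y <• r) * s := by rw [hf, mul_assoc, hrs, mul_one]
    have hsh : ‖(s : H →L[ℂ] H) h‖ ^ 2 =
        (inner ℂ h (((ip y y : M) : H →L[ℂ] H) h)).re + ε * ‖h‖ ^ 2 := by
      have h1 := norm_apply_sq s h
      rw [hs, hss] at h1
      have h2 : inner ℂ h (((ip y y + (ε : ℂ) • 1 : M) : H →L[ℂ] H) h) =
          inner ℂ h (((ip y y : M) : H →L[ℂ] H) h) + (ε : ℂ) * inner ℂ h h := by
        change inner ℂ h (((ip y y : M) : H →L[ℂ] H) h + (ε : ℂ) • h) = _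
        rw [inner_add_right, inner_smul_right]
      rw [h2] at h1
      have h3 := congrArg Complex.re h1
      rw [Complex.ofReal_re, Complex.add_re, Complex.re_ofReal_mul] at h3
      rw [← h3]
      congr 2
      exact inner_self_eq_norm_sq (𝕜 := ℂ) h
    have hC1 : ‖f (y <• r)‖ ^ 2 ≤ C ^ 2 := by
      by_cases h0 : ‖y <• r‖ = 0
      · have := hC (y <• r)
        rw [h0, mul_zero] at this
        rw [le_antisymm this (norm_nonneg _), zero_pow two_ne_zero]
        positivity
      · have h1 : 0 < ‖y <• r‖ := lt_of_le_of_ne (norm_nonneg _) (Ne.symm h0)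
        have hC0 : 0 ≤ C := nonneg_of_mul_nonneg_left ((norm_nonneg _).trans (hC _)) h1
        have : ‖f (y <• r)‖ ≤ C := (hC _).trans (mul_le_of_le_one_right hC0 hyr)
        gcongr
    rw [← hsh, hfy]
    calc ‖(f (y <• r) : H →L[ℂ] H) ((s : H →L[ℂ] H) h)‖ ^ 2
        ≤ (‖f (y <• r)‖ * ‖(s : H →L[ℂ] H) h‖) ^ 2 := by
          gcongr
          exact ContinuousLinearMap.le_opNorm _ _
      _ = ‖f (y <• r)‖ ^ 2 * ‖(s : H →L[ℂ] H) h‖ ^ 2 := mul_pow _ _ _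
      _ ≤ _ := by gcongr
  have hlim : Tendsto (fun ε : ℝ => C ^ 2 * ((inner ℂ h (((ip y y : M) : H →L[ℂ] H) h)).re +
      ε * ‖h‖ ^ 2)) (𝓝[>] 0) (𝓝 (C ^ 2 * ((inner ℂ h (((ip y y : M) : H →L[ℂ] H) h)).re +
      0 * ‖h‖ ^ 2))) := by
    refine Tendsto.mono_left ?_ nhdsWithin_le_nhds
    exact Continuous.tendsto (by fun_prop) 0
  rw [zero_mul, add_zero] at hlim
  exact ge_of_tendsto hlim (eventually_nhdsWithin_of_forall fun ε hε => key ε hε)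

end Basic

/-! ### The strong and the weak topology -/

section Topologies

variable {M : VonNeumannAlgebra H} {X : Type*} [NormedAddCommGroup X] [NormedSpace ℂ X]
  [Module (↥M)ᵐᵒᵖ X] [HilbertModule M X]

theorem strongSeminorm_sq {φ : M →ₗ[ℂ] ℂ} (hφ : φ ∈ M.predualPos) (x : X) :
    ((strongSeminorm M φ x ^ 2 : ℝ) : ℂ) = φ (ip x x) := by
  have h := hφ.2 _ (ip_self_pos (M := M) x)
  rw [strongSeminorm, Real.sq_sqrt (Complex.nonneg_iff.1 h).1]
  exact (Complex.eq_re_of_ofReal_le (r := 0) (by simpa using h)).symm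

theorem strongSeminorm_nonneg (φ : M →ₗ[ℂ] ℂ) (x : X) : 0 ≤ strongSeminorm M φ x :=
  Real.sqrt_nonneg _

theorem tendsto_strongSeminorm_iff {α : Type*} {l : Filter α} {φ : M →ₗ[ℂ] ℂ}
    (hφ : φ ∈ M.predualPos) {x : α → X} :
    Tendsto (fun j => strongSeminorm M φ (x j)) l (𝓝 0) ↔
      Tendsto (fun j => φ (ip (x j) (x j))) l (𝓝 0) := by
  constructor
  · intro h
    have := (Complex.continuous_ofReal.tendsto _).comp (h.pow 2)
    simpa [Function.comp_def, ← strongSeminorm_sq hφ] using this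
  · intro h
    have := Real.continuous_sqrt.tendsto _ |>.comp ((Complex.continuous_re.tendsto _).comp h)
    simpa [Function.comp_def, strongSeminorm] using this

theorem strongSeminorm_smul {φ : M →ₗ[ℂ] ℂ} (c : ℝ) (x : X) :
    strongSeminorm M φ ((c : ℂ) • x) = |c| * strongSeminorm M φ x := by
  rw [strongSeminorm, strongSeminorm, ip_smul_left, ip_smul_right, smul_smul, map_smul,
    Complex.star_def, Complex.conj_ofReal, ← Complex.ofReal_mul, smul_eq_mul,
    Complex.re_ofReal_mul, Real.sqrt_mul (mul_self_nonneg c), Real.sqrt_mul_self_eq_abs]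

/-- The functionals defining the weak topology are strongly continuous. -/
theorem exists_norm_apply_ip_le {φ : M →ₗ[ℂ] ℂ} (hφ : φ ∈ M.predual) :
    ∃ C : ℝ, ∃ ω ∈ M.predualPos, ∀ y z : X,
      ‖φ (ip y z)‖ ≤ C * ‖y‖ * strongSeminorm M ω z := by
  obtain ⟨v, w, hv, hw, h⟩ := hφ
  obtain ⟨ω, hω, h'⟩ := exists_mem_predualPos M hw
  refine ⟨√(∑' n, ‖v n‖ ^ 2), ω, hω, fun y z => ?_⟩
  -- The Cauchy-Schwarz inequality, first in the module and then for square-summable sequences.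
  have hre := Complex.hasSum_re (h' (ip z z))
  have hle (n : ℕ) : ‖((ip y z : M) : H →L[ℂ] H) (w n)‖ ^ 2 ≤
      ‖y‖ ^ 2 * (inner ℂ (w n) (((ip z z : M) : H →L[ℂ] H) (w n))).re :=
    norm_ip_apply_sq_le y z (w n)
  have hs : Summable fun n => ‖((ip y z : M) : H →L[ℂ] H) (w n)‖ ^ 2 :=
    Summable.of_nonneg_of_le (fun n => by positivity) hle (hre.summable.mul_left _)
  have hsum := summable_mul_of_summable_sq hv hs
  have h1 : ∑' n, ‖((ip y z : M) : H →L[ℂ] H) (w n)‖ ^ 2 ≤ ‖y‖ ^ 2 * (ω (ip z z)).re := by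
    rw [← hre.tsum_eq, ← tsum_mul_left]
    exact hs.tsum_le_tsum hle (hre.summable.mul_left _)
  have hCS := Real.inner_le_Lp_mul_Lq_tsum_of_nonneg Real.HolderConjugate.two_two
    (fun n => norm_nonneg (v n)) (fun n => norm_nonneg (((ip y z : M) : H →L[ℂ] H) (w n)))
    (by simpa using hv) (by simpa using hs)
  simp only [Real.rpow_two, ← Real.sqrt_eq_rpow] at hCS
  calc ‖φ (ip y z)‖ ≤ ∑' n, ‖v n‖ * ‖((ip y z : M) : H →L[ℂ] H) (w n)‖ := by
        rw [← (h (ip y z)).tsum_eq]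
        exact tsum_of_norm_bounded hsum.hasSum fun n => norm_inner_le_norm _ _
    _ ≤ √(∑' n, ‖v n‖ ^ 2) * √(∑' n, ‖((ip y z : M) : H →L[ℂ] H) (w n)‖ ^ 2) := hCS
    _ ≤ √(∑' n, ‖v n‖ ^ 2) * √(‖y‖ ^ 2 * (ω (ip z z)).re) := by gcongr
    _ = _ := by
        rw [Real.sqrt_mul (by positivity), Real.sqrt_sq (norm_nonneg _), ← mul_assoc]
        rfl

/-- Strong convergence implies weak convergence. -/
theorem tendsto_apply_ip_of_strong {α : Type*} {l : Filter α} {u : α → X} {x : X}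
    (h : ∀ φ ∈ M.predualPos, Tendsto (fun j => strongSeminorm M φ (u j - x)) l (𝓝 0))
    {φ : M →ₗ[ℂ] ℂ} (hφ : φ ∈ M.predual) (y : X) :
    Tendsto (fun j => φ (ip y (u j))) l (𝓝 (φ (ip y x))) := by
  obtain ⟨C, ω, hω, hle⟩ := exists_norm_apply_ip_le (X := X) hφ
  rw [tendsto_iff_norm_sub_tendsto_zero]
  refine squeeze_zero (fun _ => norm_nonneg _) (fun j => ?_)
    (by simpa using (h ω hω).const_mul (C * ‖y‖))
  rw [← map_sub, ← ip_sub_right]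
  exact hle y (u j - x)

/-- Weak convergence tests the inner product in either variable. -/
theorem tendsto_apply_ip_left {α : Type*} {l : Filter α} {u : α → X} {x y : X}
    (h : ∀ φ ∈ M.predual, Tendsto (fun j => φ (ip y (u j))) l (𝓝 (φ (ip y x))))
    {φ : M →ₗ[ℂ] ℂ} (hφ : φ ∈ M.predual) :
    Tendsto (fun j => φ (ip (u j) y)) l (𝓝 (φ (ip x y))) := by
  obtain ⟨ψ, hψ, e⟩ := exists_mem_predual_star hφ
  simp only [← star_ip (M := M) _ y, e]
  exact (h ψ hψ).star

end Topologies

/-! ### Weakly complete unit balls -/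

section Weak

variable {M : VonNeumannAlgebra H} {X : Type*} [NormedAddCommGroup X] [NormedSpace ℂ X]
  [Module (↥M)ᵐᵒᵖ X] [HilbertModule M X]

/-- The strong seminorms are lower semicontinuous for the weak topology; hence a weak limit of
a strongly Cauchy filter is a strong limit. -/
theorem UnitBallWeaklyComplete.unitBallStronglyComplete (h : UnitBallWeaklyComplete M X) :
    UnitBallStronglyComplete M X := by
  intro F hF hB hS
  obtain ⟨x, hx, hlim⟩ := h F hF hB fun φ hφ y => by
    obtain ⟨C, ω, hω, hle⟩ := exists_norm_apply_ip_le (X := X) hφ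
    rw [cauchy_map_iff, tendsto_uniformity_iff_dist_tendsto_zero]
    refine ⟨hF, squeeze_zero (fun _ => dist_nonneg) (fun p => ?_)
      (by simpa using (hS ω hω).const_mul (C * ‖y‖))⟩
    rw [dist_eq_norm, ← map_sub, ← ip_sub_right]
    exact hle y (p.1 - p.2)
  refine ⟨x, hx, fun φ hφ => ?_⟩
  rw [tendsto_order]
  refine ⟨fun b hb => Eventually.of_forall fun _ => hb.trans_le (strongSeminorm_nonneg _ _),
    fun ε hε => ?_⟩
  have hε2 := half_pos hε
  have h1 := ((hS φ hφ).eventually (gt_mem_nhds hε2)).curry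
  refine h1.mono fun y hy => ?_
  suffices strongSeminorm M φ (y - x) ^ 2 ≤ (ε / 2) ^ 2 by
    have := (sq_le_sq₀ (strongSeminorm_nonneg φ (y - x)) hε2.le).1 this
    linarith
  -- With `u = y - x` and `u' = y - y'`, the form `⟨u', u'⟩` is bounded below by
  -- `⟨u, u'⟩ + ⟨u', u⟩ - ⟨u, u⟩`, which converges weakly to `⟨u, u⟩` as `y'` tends to `x`.
  have hw (z : X) (ψ : M →ₗ[ℂ] ℂ) (hψ : ψ ∈ M.predual) :
      Tendsto (fun y' => ψ (ip z (y - y'))) F (𝓝 (ψ (ip z (y - x)))) := by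
    simp only [ip_sub_right, map_sub]
    exact (hlim ψ hψ z).const_sub _
  have t1 := hw (y - x) φ hφ.1
  have t2 := tendsto_apply_ip_left (hw (y - x)) hφ.1
  have t3 : Tendsto (fun y' => (φ (ip (y - x) (y - y')) + φ (ip (y - y') (y - x)) -
      φ (ip (y - x) (y - x))).re) F (𝓝 (strongSeminorm M φ (y - x) ^ 2)) := by
    have := (Complex.continuous_re.tendsto _).comp
      ((t1.add t2).sub_const (φ (ip (y - x) (y - x))))
    rw [add_sub_cancel_right] at this
    rwa [← Complex.ofReal_re (strongSeminorm M φ (y - x) ^ 2),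
      strongSeminorm_sq hφ]
  refine le_of_tendsto t3 (hy.mono fun y' hy' => ?_)
  have h2 : strongSeminorm M φ (y - y') ^ 2 ≤ (ε / 2) ^ 2 :=
    pow_le_pow_left₀ (strongSeminorm_nonneg _ _) hy'.le 2
  refine le_trans ?_ h2
  have h3 := (Complex.nonneg_iff.1
    (hφ.2 _ (ip_self_pos (M := M) ((y - x) - (y - y'))))).1
  have h4 := congrArg Complex.re (strongSeminorm_sq hφ (y - y'))
  rw [Complex.ofReal_re] at h4
  rw [h4]
  rw [ip_sub_right, ip_sub_left (y - x) (y - y') (y - x), ip_sub_left (y - x) (y - y') (y - y'),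
    map_sub, map_sub, map_sub] at h3
  simp only [Complex.sub_re, Complex.add_re] at h3 ⊢
  linarith

/-- The weak limit of a filter on the unit ball exists as a bounded module map, which self-duality
represents by an element. -/
theorem SelfDual.unitBallWeaklyComplete (h : SelfDual M X) : UnitBallWeaklyComplete M X := by
  intro F hF hB hW
  have hB' (y : X) : ∀ᶠ x in F, ‖(ip y x : M)‖ ≤ ‖y‖ := by
    filter_upwards [hB] with x hx
    rw [mem_closedBall_zero_iff] at hx
    exact (norm_ip_le y x).trans (mul_le_of_le_one_right (norm_nonneg _) hx)
  have key (y : X) := exists_ultraweak_limit (M := M) (a := fun x : X => ip y x) (hB' y)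
    fun u v => by
      obtain ⟨φ, hφ, e⟩ := exists_mem_predual_eq_inner M u v
      obtain ⟨z, hz⟩ := CompleteSpace.complete (hW φ hφ y)
      exact ⟨z, by simp only [← e]; exact hz⟩
  choose b hb hlim using key
  have badd (y z : X) : b (y + z) = b y + b z := ext_predual fun φ hφ => by
    rw [map_add]
    exact tendsto_nhds_unique (hlim _ φ hφ) (((hlim y φ hφ).add (hlim z φ hφ)).congr fun x => by
      rw [ip_add_left, map_add])
  have bact (y : X) (a : M) : b (y <• a) = star a * b y := ext_inner fun u v => by
    obtain ⟨φ, hφ, e⟩ := exists_mem_predual_eq_inner M u v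
    obtain ⟨ψ, hψ, e'⟩ := exists_mem_predual_eq_inner M ((a : H →L[ℂ] H) u) v
    have e'' (c : M) : φ (star a * c) = ψ c := by
      rw [e, e', ← ContinuousLinearMap.adjoint_inner_right]
      rfl
    rw [← e, ← e, e'']
    exact tendsto_nhds_unique (hlim _ φ hφ) ((hlim y ψ hψ).congr fun x => by
      rw [ip_action_left, e''])
  let g : X →ₗ[(↥M)ᵐᵒᵖ] M :=
    { toFun := fun y => star (b y)
      map_add' := fun y z => by rw [badd, star_add]
      map_smul' := fun a y => by
        have := bact y a.unop
        rw [MulOpposite.op_unop] at this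
        rw [this, star_mul, star_star]
        rfl }
  have hg (y : X) : ‖g y‖ ≤ 1 * ‖y‖ := by
    rw [one_mul]
    exact (norm_star (b y : H →L[ℂ] H)).trans_le (hb y)
  obtain ⟨x, hx, -⟩ := h ⟨g, AddMonoidHomClass.continuous_of_bound g 1 hg⟩
  have hx' (y : X) : ip y x = b y := by
    rw [← star_ip, ← hx y]
    exact star_star (b y)
  refine ⟨x, ?_, fun φ hφ y => by rw [hx']; exact hlim y φ hφ⟩
  rw [mem_closedBall_zero_iff]
  have h1 := hb x
  rw [← hx', norm_ip_self] at h1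
  by_contra! hlt
  nlinarith

end Weak

/-! ### Orthonormal families -/

section Orthonormal

variable {M : VonNeumannAlgebra H} {X : Type*} [NormedAddCommGroup X] [NormedSpace ℂ X]
  [Module (↥M)ᵐᵒᵖ X] [HilbertModule M X] {ι : Type*}

variable (M) in
/-- A family of pairwise orthogonal vectors `e i` whose squares `⟨e i, e i⟩` are projections. -/
structure IsOrthonormal (e : ι → X) : Prop where
  isStarProjection : ∀ i, IsStarProjection (ip (e i) (e i) : M)
  ip_eq_zero : ∀ i j, i ≠ j → (ip (e i) (e j) : M) = 0

theorem action_ip_self {x : X} (h : IsStarProjection (ip x x : M)) : x <• (ip x x : M) = x := by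
  have h1 := h.isIdempotentElem.eq
  have h2 := h.isSelfAdjoint.star_eq
  rw [← sub_eq_zero, ← ip_self_eq_zero (M := M), ip_sub_right, ip_sub_left, ip_sub_left,
    ip_action_right, ip_action_right, ip_action_left, h2, h1, h1, sub_self]

theorem ip_self_mul_ip {x : X} (h : IsStarProjection (ip x x : M)) (y : X) :
    (ip x x : M) * ip x y = ip x y := by
  conv_rhs => rw [← action_ip_self h, ip_action_left, star_ip]

theorem IsOrthonormal.ip_sum [DecidableEq ι] {e : ι → X} (he : IsOrthonormal M e) {x : ι → M}
    (hx : ∀ i, ip (e i) (e i) * x i = x i) (s : Finset ι) (i : ι) :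
    ip (e i) (∑ j ∈ s, e j <• x j) = if i ∈ s then x i else 0 := by
  rw [ip_sum_right]
  have (j : ι) : ip (e i) (e j <• x j) = if i = j then x j else 0 := by
    rw [ip_action_right]
    split_ifs with h
    · rw [h, hx]
    · rw [he.ip_eq_zero i j h, zero_mul]
  simp only [this, Finset.sum_ite_eq]

theorem IsOrthonormal.ip_sum_sum [DecidableEq ι] {e : ι → X} (he : IsOrthonormal M e) {x : ι → M}
    (hx : ∀ i, ip (e i) (e i) * x i = x i) (s t : Finset ι) :
    (ip (∑ i ∈ s, e i <• x i) (∑ i ∈ t, e i <• x i) : M) =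
      ∑ i ∈ s ∩ t, star (x i) * x i := by
  rw [ip_sum_left]
  simp only [ip_action_left, he.ip_sum hx, mul_ite, mul_zero, Finset.sum_ite_mem]

/-- The sharp form of Bessel's inequality. -/
theorem IsOrthonormal.ip_sub_sum [DecidableEq ι] {e : ι → X} (he : IsOrthonormal M e) (y : X)
    (s : Finset ι) :
    (ip (y - ∑ i ∈ s, e i <• (ip (e i) y : M)) (y - ∑ i ∈ s, e i <• (ip (e i) y : M)) : M) =
      ip y y - ∑ i ∈ s, star (ip (e i) y) * ip (e i) y := by
  have h1 : (ip (∑ i ∈ s, e i <• (ip (e i) y : M)) y : M) =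
      ∑ i ∈ s, star (ip (e i) y) * ip (e i) y := by
    rw [ip_sum_left]
    simp only [ip_action_left]
  have h2 : (ip y (∑ i ∈ s, e i <• (ip (e i) y : M)) : M) =
      ∑ i ∈ s, star (ip (e i) y) * ip (e i) y := by
    rw [ip_sum_right]
    simp only [ip_action_right, star_ip]
  rw [ip_sub_left, ip_sub_right, ip_sub_right, h1, h2,
    he.ip_sum_sum (fun i => ip_self_mul_ip (he.isStarProjection i) y), Finset.inter_self, sub_self,
    sub_zero]

theorem IsOrthonormal.bessel {e : ι → X} (he : IsOrthonormal M e) (y : X) (s : Finset ι) :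
    ∑ i ∈ s, star (ip (e i) y) * ip (e i) y ≤ (ip y y : M) := by
  classical
  change ((ip y y - ∑ i ∈ s, star (ip (e i) y) * ip (e i) y : M) : H →L[ℂ] H).IsPositive
  rw [← he.ip_sub_sum]
  exact ip_self_pos _

end Orthonormal

/-! ### Ultraweak direct sums are self-dual -/

section Principal

universe v

variable {M : VonNeumannAlgebra H} {X : Type v} [NormedAddCommGroup X] [NormedSpace ℂ X]
  [Module (↥M)ᵐᵒᵖ X] [HilbertModule M X]

/-- In an ultraweak direct sum, the coordinates of a vector are its inner products with an
orthonormal family, and all coordinates in the direct sum occur. -/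
theorem IsPrincipal.exists_orthonormal (h : IsPrincipal M X) :
    ∃ (ι : Type v) (e : ι → X), IsOrthonormal M e ∧
      (∀ y : X, M.HasUltraweakSum (fun i => star (ip (e i) y) * ip (e i) y) (ip y y)) ∧
      ∀ x : ι → M, (∀ i, ip (e i) (e i) * x i = x i) →
        (∃ a : M, M.HasUltraweakSum (fun i => star (x i) * x i) a) →
        ∃ y : X, ∀ i, ip (e i) y = x i := by
  classical
  obtain ⟨ι, q, hq, T, hT, hip⟩ := h
  -- The orthonormal family consists of the vectors whose only nonzero coordinate is `q i`.
  have hmem (i : ι) : Pi.single i (q i) ∈ M.ultraweakDirectSum q := by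
    refine ⟨fun j => ?_, star (q i) * q i, fun φ hφ => ?_⟩
    · by_cases hj : j = i
      · subst hj
        exact ⟨1, by simp⟩
      · exact ⟨0, by simp [hj]⟩
    · have := hasSum_single (f := fun j => φ (star ((Pi.single i (q i) : ι → M) j) *
        (Pi.single i (q i) : ι → M) j)) i fun j hj => by simp [hj]
      simpa using this
  choose e _ he using fun i => hT.surjOn (hmem i)
  have hTq (y : X) (i : ι) : q i * T y i = T y i := by
    obtain ⟨a, ha⟩ := (hT.mapsTo (Set.mem_univ y)).1 i
    rw [ha, ← mul_assoc, (hq i).isIdempotentElem.eq]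
  have heT (i : ι) (y : X) : ip (e i) y = T y i := ext_predual fun φ hφ => by
    refine (hip (e i) y φ hφ).unique ?_
    have := hasSum_single (f := fun j => φ (star (T (e i) j) * T y j)) i fun j hj => by
      simp [he, hj]
    simpa [he, (hq i).isSelfAdjoint.star_eq, hTq] using this
  have hee (i j : ι) : (ip (e i) (e j) : M) = (Pi.single j (q j) : ι → M) i := by rw [heT, he]
  refine ⟨ι, e, ⟨fun i => by simpa [hee] using hq i, fun i j hij => by simp [hee, hij]⟩,
    fun y => ?_, fun x hx ha => ?_⟩
  · simp only [heT]
    exact hip y y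
  · obtain ⟨y, -, hy⟩ := hT.surjOn (show x ∈ M.ultraweakDirectSum q from
      ⟨fun i => ⟨x i, by rw [← hx i, hee]; simp [← mul_assoc, (hq i).isIdempotentElem.eq]⟩, ha⟩)
    exact ⟨y, fun i => by rw [heT, hy]⟩

/-- A continuous module map is bounded. -/
theorem exists_bound (f : X →L[(↥M)ᵐᵒᵖ] M) : ∃ C, 0 ≤ C ∧ ∀ y, ‖f y‖ ≤ C * ‖y‖ := by
  let g : X →ₗ[ℂ] M :=
    { toFun := f
      map_add' := map_add f
      map_smul' := fun c y => by
        rw [← action_smul_one (M := M) c y, map_smul, RingHom.id_apply]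
        change f y * (c • 1) = _
        rw [mul_smul_comm, mul_one] }
  let G : X →L[ℂ] M := ⟨g, f.continuous⟩
  exact ⟨‖G‖, norm_nonneg _, G.le_opNorm⟩

theorem IsPrincipal.selfDual (h : IsPrincipal M X) : SelfDual M X := by
  classical
  intro f
  obtain ⟨ι, e, he, hparseval, hsurj⟩ := h.exists_orthonormal
  obtain ⟨C, hC0, hC⟩ := exists_bound f
  have hf (y : X) (a : M) : f (y <• a) = f y * a := map_smul f (MulOpposite.op a) y
  have hfe (i : ι) : ip (e i) (e i) * star (f (e i)) = star (f (e i)) := by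
    conv_rhs => rw [← action_ip_self (he.isStarProjection i), hf, star_mul, star_ip]
  -- Applying `f` to `η = ∑ i ∈ s, e i f(e i)*` gives `⟨η, η⟩`, so `‖η‖ ≤ ‖f‖`.
  obtain ⟨x, hx⟩ := hsurj (fun i => star (f (e i))) hfe <| by
    refine exists_hasUltraweakSum (C := C ^ 2) fun s => ?_
    set η : X := ∑ i ∈ s, e i <• star (f (e i)) with hη
    have h1 : (ip η η : M) = ∑ i ∈ s, star (star (f (e i))) * star (f (e i)) := by
      rw [he.ip_sum_sum hfe, Finset.inter_self]
    have h2 : f η = ip η η := by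
      rw [h1, hη, map_sum]
      simp only [hf, star_star]
    have h3 := hC η
    rw [h2, norm_ip_self] at h3
    rw [← h1, norm_ip_self]
    have h4 : ‖η‖ ≤ C := by
      by_contra! hlt
      nlinarith [norm_nonneg η]
    gcongr
  have hx' (i : ι) : ip x (e i) = f (e i) := by rw [← star_ip, hx, star_star]
  suffices hfx : ∀ y, f y = ip x y from ⟨x, hfx, fun z hz => ext_ip M fun y => by
    rw [← star_ip, ← hz, hfx, star_ip]⟩
  intro y
  -- `f - ⟨x, ·⟩` vanishes on the span of the `e i`, and is strongly continuous.
  have hbd (z : X) : ‖f z - ip x z‖ ≤ (C + ‖x‖) * ‖z‖ := by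
    rw [add_mul]
    exact (norm_sub_le _ _).trans (add_le_add (hC z) (norm_ip_le x z))
  have hmod (z : X) (a : M) : f (z <• a) - ip x (z <• a) = (f z - ip x z) * a := by
    rw [hf, ip_action_right, sub_mul]
  rw [← sub_eq_zero]
  refine Subtype.ext (ContinuousLinearMap.ext fun u => ?_)
  obtain ⟨φ, hφ, e'⟩ := exists_mem_predual_eq_inner M u u
  have hs (s : Finset ι) : ‖((f y - ip x y : M) : H →L[ℂ] H) u‖ ^ 2 ≤ (C + ‖x‖) ^ 2 *
      (φ (ip y y) - ∑ i ∈ s, φ (star (ip (e i) y) * ip (e i) y)).re := by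
    have h0 : f y - ip x y = f (y - ∑ i ∈ s, e i <• (ip (e i) y : M)) -
        ip x (y - ∑ i ∈ s, e i <• (ip (e i) y : M)) := by
      rw [map_sub, map_sum, ip_sub_right, ip_sum_right]
      simp only [hf, ip_action_right, hx']
      abel
    have h1 := norm_map_apply_sq_le (fun z => f z - ip x z) hbd hmod
      (y - ∑ i ∈ s, e i <• (ip (e i) y : M)) u
    rw [← e', he.ip_sub_sum, map_sub φ, map_sum φ] at h1
    rw [h0]
    exact h1
  have hlim : Tendsto (fun s : Finset ι => (C + ‖x‖) ^ 2 *
      (φ (ip y y) - ∑ i ∈ s, φ (star (ip (e i) y) * ip (e i) y)).re) atTop (𝓝 0) := by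
    have := ((Complex.continuous_re.tendsto _).comp
      (Tendsto.const_sub (φ (ip y y)) (hparseval y φ hφ))).const_mul ((C + ‖x‖) ^ 2)
    simpa using this
  have h0 := ge_of_tendsto hlim (Eventually.of_forall hs)
  have : ‖((f y - ip x y : M) : H →L[ℂ] H) u‖ = 0 :=
    pow_eq_zero_iff two_ne_zero |>.1 (le_antisymm h0 (by positivity))
  exact norm_eq_zero.1 this

end Principal

/-! ### Strongly complete unit balls -/

section StronglyComplete

variable {M : VonNeumannAlgebra H} {X : Type*} [NormedAddCommGroup X] [NormedSpace ℂ X]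
  [Module (↥M)ᵐᵒᵖ X] [HilbertModule M X]

/-- Strong completeness of the unit ball passes to all balls by scaling. -/
theorem UnitBallStronglyComplete.exists_limit (h : UnitBallStronglyComplete M X)
    {α : Type*} {l : Filter α} [l.NeBot] {u : α → X} {C : ℝ} (hC : ∀ j, ‖u j‖ ≤ C)
    (hu : ∀ φ ∈ M.predualPos,
      Tendsto (fun p : α × α => φ (ip (u p.1 - u p.2) (u p.1 - u p.2))) (l ×ˢ l) (𝓝 0)) :
    ∃ x : X, ∀ φ ∈ M.predualPos, Tendsto (fun j => strongSeminorm M φ (u j - x)) l (𝓝 0) := by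
  set c : ℝ := (|C| + 1)⁻¹ with hc
  have hc0 : 0 < c := by positivity
  have hc1 : (c : ℂ) ≠ 0 := Complex.ofReal_ne_zero.2 hc0.ne'
  obtain ⟨x, -, hx⟩ := h (l.map fun j => (c : ℂ) • u j) inferInstance
    (mem_map.2 <| univ_mem' fun j => by
      rw [Set.mem_preimage, mem_closedBall_zero_iff, norm_smul, Complex.norm_real,
        Real.norm_of_nonneg hc0.le, hc, inv_mul_le_iff₀ (by positivity), mul_one]
      linarith [hC j, le_abs_self C])
    (fun φ hφ => by
      rw [prod_map_map_eq, tendsto_map'_iff]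
      have := ((tendsto_strongSeminorm_iff hφ).2 (hu φ hφ)).const_mul |c|
      simpa only [mul_zero, ← strongSeminorm_smul, smul_sub, Function.comp_def] using this)
  refine ⟨(c : ℂ)⁻¹ • x, fun φ hφ => ?_⟩
  have := (tendsto_map'_iff.1 (hx φ hφ)).const_mul |c⁻¹|
  rw [mul_zero] at this
  refine this.congr fun j => ?_
  rw [Function.comp_apply, ← strongSeminorm_smul, smul_sub, smul_smul, Complex.ofReal_inv,
    inv_mul_cancel₀ hc1, one_smul]

/-- Polar decomposition: if the unit ball is strongly complete, then `x ⟨x, x⟩^(-1/2)` makes sense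
as the strong limit `z` of `x (⟨x, x⟩ + ε)^(-1/2)`. -/
theorem UnitBallStronglyComplete.exists_isStarProjection (h : UnitBallStronglyComplete M X)
    {x : X} (hx : x ≠ 0) :
    ∃ z : X, z ≠ 0 ∧ IsStarProjection (ip z z : M) ∧
      ∀ y : X, (ip y x : M) = 0 → (ip y z : M) = 0 := by
  obtain ⟨r, hr, hle, hdiff, hcomm, hlim⟩ := exists_regularization (ip x x : M) (ip_self_pos x)
  set a : M := ip x x with ha
  have hz (m n : ℕ) : (ip (x <• r n - x <• r m) (x <• r n - x <• r m) : M) =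
      (r n - r m) * a * (r n - r m) := by
    have : x <• r n - x <• r m = x <• (r n - r m) := by
      rw [MulOpposite.op_sub, sub_smul]
    rw [this, ip_action_left, ip_action_right, star_sub, hr, hr, mul_assoc]
  have hzz (n : ℕ) : (ip (x <• r n) (x <• r n) : M) = r n * a * r n := by
    rw [ip_action_left, ip_action_right, hr, mul_assoc]
  have hmono {φ : M →ₗ[ℂ] ℂ} (hφ : φ ∈ M.predualPos) (m n : ℕ) (hmn : m ≤ n) :
      (φ (ip (x <• r n - x <• r m) (x <• r n - x <• r m))).re ≤
        (φ (r n * a * r n)).re - (φ (r m * a * r m)).re := by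
    have := (Complex.le_def.1 (predualPos_mono hφ (hdiff m n hmn))).1
    rwa [← hz, map_sub, Complex.sub_re] at this
  have hpos {φ : M →ₗ[ℂ] ℂ} (hφ : φ ∈ M.predualPos) (y : X) : 0 ≤ (φ (ip y y)).re :=
    (Complex.nonneg_iff.1 (hφ.2 _ (ip_self_pos y))).1
  have hnorm (n : ℕ) : ‖x <• r n‖ ≤ 1 :=
    norm_le_one_of_ip_self_le_one ((hzz n).trans_le (hle n))
  obtain ⟨z, hzlim⟩ := h.exists_limit (l := atTop) (u := fun n => x <• r n) hnorm fun φ hφ => by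
      -- The increasing bounded sequence `φ (r n * a * r n)` is Cauchy.
      have hmon : Monotone fun n => (φ (r n * a * r n)).re := fun m n hmn =>
        sub_nonneg.1 ((hpos hφ _).trans (hmono hφ m n hmn))
      have hconv := tendsto_atTop_ciSup hmon ⟨(φ 1).re, by
        rintro _ ⟨n, rfl⟩
        exact (Complex.le_def.1 (predualPos_mono hφ (hle n))).1⟩
      have hd : Tendsto (fun p : ℕ × ℕ => |(φ (r p.1 * a * r p.1)).re -
          (φ (r p.2 * a * r p.2)).re|) (atTop ×ˢ atTop) (𝓝 0) := by
        have := ((hconv.comp (tendsto_fst (g := atTop))).sub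
          (hconv.comp (tendsto_snd (f := atTop)))).abs
        simpa using this
      rw [← tendsto_strongSeminorm_iff hφ]
      have hsq : Tendsto (fun p : ℕ × ℕ => √|(φ (r p.1 * a * r p.1)).re -
          (φ (r p.2 * a * r p.2)).re|) (atTop ×ˢ atTop) (𝓝 0) := by
        simpa [Function.comp_def] using (Real.continuous_sqrt.tendsto _).comp hd
      refine squeeze_zero (fun _ => strongSeminorm_nonneg _ _) (fun p => ?_) hsq
      refine Real.sqrt_le_sqrt ?_
      rcases le_total p.2 p.1 with hp | hp
      · exact (hmono hφ _ _ hp).trans (le_abs_self _)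
      · have := hmono hφ _ _ hp
        rw [hz] at this ⊢
        rw [abs_sub_comm, ← neg_sub (r p.2), neg_mul, neg_mul_neg]
        exact this.trans (le_abs_self _)
  have hw (y : X) (φ : M →ₗ[ℂ] ℂ) (hφ : φ ∈ M.predual) :
      Tendsto (fun n => φ (ip y (x <• r n))) atTop (𝓝 (φ (ip y z))) :=
    tendsto_apply_ip_of_strong hzlim hφ y
  -- `⟨z, z⟩` is the ultraweak limit of `⟨x r n, x r n⟩`: pass to the limit in both variables.
  have hp (φ : M →ₗ[ℂ] ℂ) (hφ : φ ∈ M.predual) :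
      Tendsto (fun n => φ (r n * a * r n)) atTop (𝓝 (φ (ip z z))) := by
    obtain ⟨C, ω, hω, hC⟩ := exists_norm_apply_ip_le (X := X) hφ
    have h1 : Tendsto (fun n => φ (ip (x <• r n) (x <• r n - z))) atTop (𝓝 0) := by
      refine squeeze_zero_norm (fun n => (hC _ _).trans (mul_le_mul_of_nonneg_right
        (?_ : C * ‖x <• r n‖ ≤ |C|) (strongSeminorm_nonneg _ _)))
        (by simpa using (hzlim ω hω).const_mul |C|)
      exact (mul_le_mul_of_nonneg_right (le_abs_self C) (norm_nonneg _)).trans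
        (mul_le_of_le_one_right (abs_nonneg C) (hnorm n))
    have h2 := h1.add (tendsto_apply_ip_left (hw z) hφ)
    rw [zero_add] at h2
    refine h2.congr fun n => ?_
    rw [← map_add, ip_sub_right, sub_add_cancel, hzz]
  have hpa : (ip z z : M) * a = a := ext_inner fun u v => by
    obtain ⟨φ, hφ, e⟩ := exists_mem_predual_eq_inner M u ((a : H →L[ℂ] H) v)
    have h1 : Tendsto (fun n => inner ℂ u (((r n * a * r n * a : M) : H →L[ℂ] H) v)) atTop
        (𝓝 (inner ℂ u ((a : H →L[ℂ] H) v))) := by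
      have hc : Continuous fun b : M => inner ℂ u ((b : H →L[ℂ] H) v) :=
        continuous_const.inner (continuous_subtype_val.clm_apply continuous_const)
      exact (hc.tendsto a).comp hlim
    refine tendsto_nhds_unique ?_ h1
    have h2 := hp φ hφ
    simp only [e] at h2
    exact h2
  have hpp : (ip z z : M) * ip z z = ip z z := ext_inner fun u v => by
    obtain ⟨φ, hφ, e⟩ := exists_mem_predual_eq_inner M u v
    obtain ⟨ψ, hψ, e'⟩ := exists_mem_predual_eq_inner M (((ip z z : M) : H →L[ℂ] H) u) v
    have hψφ (b : M) : ψ b = φ (ip z z * b) := by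
      rw [e, e']
      exact (ip_self_pos z).inner_left_eq_inner_right _ _
    rw [← e, ← e, ← hψφ]
    refine tendsto_nhds_unique (hp ψ hψ) ((hp φ hφ).congr fun n => ?_)
    rw [hψφ, hcomm, ← mul_assoc (ip z z), hpa]
  refine ⟨z, ?_, ⟨hpp, star_ip z z⟩, fun y hy => ext_predual fun φ hφ => ?_⟩
  · rintro rfl
    rw [ip_zero_right, zero_mul] at hpa
    exact hx ((ip_self_eq_zero (M := M) x).1 hpa.symm)
  · refine tendsto_nhds_unique (hw y φ hφ) ?_
    simp only [ip_action_right, hy, zero_mul]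
    exact tendsto_const_nhds

/-- A maximal orthonormal family exists. It may contain `0`, so maximality is stated as: a vector
orthogonal to the family whose square is a projection vanishes. -/
theorem exists_maximal_orthonormal (M : VonNeumannAlgebra H) (X : Type*) [NormedAddCommGroup X]
    [NormedSpace ℂ X] [Module (↥M)ᵐᵒᵖ X] [HilbertModule M X] :
    ∃ S : Set X, IsOrthonormal M (fun e : S => (e : X)) ∧
      ∀ z : X, IsStarProjection (ip z z : M) → (∀ e ∈ S, (ip e z : M) = 0) → z = 0 := by
  obtain ⟨S, hS, hmax⟩ := zorn_subset
    {S : Set X | (∀ e ∈ S, IsStarProjection (ip e e : M)) ∧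
      S.Pairwise fun e e' => (ip e e' : M) = 0} fun c hc hchain =>
    ⟨⋃₀ c, ⟨fun e ⟨s, hs, he⟩ => (hc hs).1 e he,
      (Set.pairwise_sUnion hchain.directedOn).2 fun s hs => (hc hs).2⟩,
      fun s hs => Set.subset_sUnion_of_mem hs⟩
  refine ⟨S, ⟨fun i => hS.1 i i.2, fun i j hij => hS.2 i.2 j.2 (Subtype.coe_ne_coe.2 hij)⟩,
    fun z hz horth => ?_⟩
  have hins : insert z S ∈ {S : Set X | (∀ e ∈ S, IsStarProjection (ip e e : M)) ∧
      S.Pairwise fun e e' => (ip e e' : M) = 0} := by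
    refine ⟨Set.forall_mem_insert.2 ⟨hz, hS.1⟩, hS.2.insert fun e he _ => ⟨?_, horth e he⟩⟩
    rw [← star_ip, horth e he, star_zero]
  exact (ip_self_eq_zero (M := M) z).1
    (horth z (hmax hins (Set.subset_insert z S) (Set.mem_insert z S)))

/-- If the unit ball is strongly complete, then `∑ i, e i x i` converges strongly along an
orthonormal family as soon as the partial sums of `∑ i, (x i)* (x i)` are bounded. -/
theorem UnitBallStronglyComplete.exists_sum (h : UnitBallStronglyComplete M X) {ι : Type*}
    {e : ι → X} (he : IsOrthonormal M e) {x : ι → M} (hx : ∀ i, ip (e i) (e i) * x i = x i)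
    {a : M} (ha : ∀ s : Finset ι, ∑ i ∈ s, star (x i) * x i ≤ a) :
    ∃ y : X, (∀ i, ip (e i) y = x i) ∧ ∀ φ ∈ M.predualPos, Tendsto
      (fun s : Finset ι => strongSeminorm M φ (∑ i ∈ s, e i <• x i - y)) atTop (𝓝 0) := by
  classical
  obtain ⟨y, hy⟩ := h.exists_limit (l := atTop) (u := fun s : Finset ι => ∑ i ∈ s, e i <• x i)
    (C := √‖a‖) (fun s => Real.le_sqrt_of_sq_le (norm_sq_le_of_ip_self_le (M := M) (by
      rw [he.ip_sum_sum hx, Finset.inter_self]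
      exact ha s))) fun φ hφ => by
    have hs : Tendsto (fun s : Finset ι => ∑ i ∈ s, φ (star (x i) * x i)) atTop
        (𝓝 (∑' i, φ (star (x i) * x i))) := (summable_predualPos hφ ha).hasSum
    simp only [ip_sub_left, ip_sub_right, he.ip_sum_sum hx, map_sub, map_sum, Finset.inter_self]
    -- The square of the difference of two partial sums is `S s - S (s ∩ t) - S (s ∩ t) + S t`
    -- with `S` the partial sums of the convergent scalar series.
    have hinter : Tendsto (fun p : Finset ι × Finset ι => p.1 ∩ p.2) (atTop ×ˢ atTop) atTop := by
      rw [tendsto_atTop]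
      intro s
      filter_upwards [prod_mem_prod (mem_atTop s) (mem_atTop s)] with p hp
      exact Finset.subset_inter hp.1 hp.2
    have hinter' : Tendsto (fun p : Finset ι × Finset ι => p.2 ∩ p.1) (atTop ×ˢ atTop) atTop := by
      simpa only [Finset.inter_comm] using hinter
    have := ((hs.comp tendsto_fst).sub (hs.comp hinter')).sub
      ((hs.comp hinter).sub (hs.comp tendsto_snd))
    simpa only [sub_self, Function.comp_def] using this
  refine ⟨y, fun i => ext_predual fun φ hφ => ?_, hy⟩
  refine tendsto_nhds_unique (tendsto_apply_ip_of_strong hy hφ (e i)) ?_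
  refine tendsto_const_nhds.congr' ?_
  filter_upwards [mem_atTop ({i} : Finset ι)] with s hs
  rw [he.ip_sum hx, if_pos (Finset.singleton_subset_iff.1 hs)]

theorem UnitBallStronglyComplete.isPrincipal (h : UnitBallStronglyComplete M X) :
    IsPrincipal M X := by
  classical
  obtain ⟨S, he, hmax⟩ := exists_maximal_orthonormal M X
  set e : S → X := fun e => e with he'
  let q : S → M := fun i => ip (e i) (e i)
  have hq (y : X) (i : S) : ip (e i) (e i) * ip (e i) y = (ip (e i) y : M) :=
    ip_self_mul_ip (he.isStarProjection i) y
  -- By maximality, `y` is the strong sum of its components `e i ⟨e i, y⟩`.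
  have hexp (y : X) : ∀ φ ∈ M.predualPos, Tendsto (fun s : Finset S =>
      strongSeminorm M φ (∑ i ∈ s, e i <• (ip (e i) y : M) - y)) atTop (𝓝 0) := by
    obtain ⟨y', hy', hlim⟩ := h.exists_sum he (hq y) (he.bessel y)
    suffices y = y' by rwa [← this] at hlim
    by_contra hne
    obtain ⟨z, hz0, hz, horth⟩ := h.exists_isStarProjection (sub_ne_zero.2 hne)
    exact hz0 (hmax z hz fun i hi => horth i (by
      rw [ip_sub_right, sub_eq_zero]
      exact (hy' ⟨i, hi⟩).symm))
  have hip (x y : X) : M.HasUltraweakSum (fun i => star (ip (e i) x) * ip (e i) y) (ip x y) :=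
    fun φ hφ => (tendsto_apply_ip_of_strong (hexp y) hφ x).congr fun s => by
      rw [ip_sum_right, map_sum]
      simp only [ip_action_right, star_ip]
  let T : X →ₗ[(↥M)ᵐᵒᵖ] (S → M) :=
    { toFun := fun y i => ip (e i) y
      map_add' := fun y z => funext fun i => ip_add_right _ _ _
      map_smul' := fun a y => funext fun i => ip_action_right a.unop _ _ }
  refine ⟨S, q, he.isStarProjection, T, ⟨fun y _ => ⟨fun i => ⟨ip (e i) y, (hq y i).symm⟩,
    ip y y, hip y y⟩, fun x _ y _ hxy => ?_, ?_⟩, hip⟩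
  · have hxy' (i : S) : (ip (e i) x : M) = ip (e i) y := congrFun hxy i
    exact ext_ip M fun z => ext_predual fun φ hφ => (hip z x φ hφ).unique (by
      simpa only [hxy'] using hip z y φ hφ)
  · rintro x ⟨hxq, a, ha⟩
    obtain ⟨y, hy, -⟩ := h.exists_sum he (x := x) (fun i => by
      obtain ⟨b, hb⟩ := hxq i
      rw [hb, ← mul_assoc, (he.isStarProjection i).isIdempotentElem.eq])
      (sum_le_of_hasUltraweakSum ha)
    exact ⟨y, Set.mem_univ y, funext hy⟩

end StronglyComplete

end HilbertModule

end VonNeumannAlgebra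

theorem mainTheorem5 {H : Type*} [NormedAddCommGroup H] [InnerProductSpace ℂ H] [CompleteSpace H]
    (M : VonNeumannAlgebra H) (X : Type*) [NormedAddCommGroup X] [NormedSpace ℂ X]
    [CompleteSpace X] [Module (↥M)ᵐᵒᵖ X] [VonNeumannAlgebra.HilbertModule M X] :
    List.TFAE
      [VonNeumannAlgebra.HilbertModule.UnitBallStronglyComplete M X,
       VonNeumannAlgebra.HilbertModule.IsPrincipal M X,
       VonNeumannAlgebra.HilbertModule.SelfDual M X,
       VonNeumannAlgebra.HilbertModule.UnitBallWeaklyComplete M X] := by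
  tfae_have 1 → 2 := VonNeumannAlgebra.HilbertModule.UnitBallStronglyComplete.isPrincipal
  tfae_have 2 → 3 := VonNeumannAlgebra.HilbertModule.IsPrincipal.selfDual
  tfae_have 3 → 4 := VonNeumannAlgebra.HilbertModule.SelfDual.unitBallWeaklyComplete
  tfae_have 4 → 1 := VonNeumannAlgebra.HilbertModule.UnitBallWeaklyComplete.unitBallStronglyComplete
  tfae_finish
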